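/- Conventions. A family of states is a sequence $\Psi=\{|\psi_0\rangle,|\psi_1\rangle,\dots\}$ in which $|\psi_i\rangle$ is a normalized pure state on a finite set $E_i$ of qubits, with $E_i\subseteq E_{i+1}$. All protocols have finitely many steps, and the choice of each step may depend on all earlier outcomes. $\Psi$ is a \emph{universal resource under local projective measurements, up to local unitary operations}, if for every $n$ and every normalized $n$-qubit state $|\phi\rangle$ there are an index $i$, a set $A\subseteq E_i$ of $n$ qubits, and an adaptive sequence of single-qubit projective measurements (in orthonormal bases) on $|\psi_i\rangle$, such that in every branch $\alpha$ of non-zero probability the final state is, up to normalization and phase, $\bigl(\bigotimes_{v\in E_i}U^{\alpha}_v\bigr)|\phi\rangle^{A}|0\rangle^{E_i\setminus A}$ for some single-qubit unitaries $U^\alpha_v$. The set $A$ and the assignment of the $n$ qubits of $|\phi\rangle$ to it are the same in all branches. An \emph{$m$-qubit encoding} is a pair of orthonormal $m$-qubit states $|\mathbf 0\rangle,|\mathbf 1\rangle$. Replace every qubit $l$ by a block $B_l$ of $m$ physical qubits, distinct blocks being disjoint. The encoded version of $|\phi\rangle=\sum_{y} c_y\bigotimes_l|y_l\rangle$ is $|\boldsymbol\phi\rangle=\sum_y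 c_y\bigotimes_l|\mathbf{y}_l\rangle_{B_l}$, and the encoded version of a one-qubit operator $U=\sum_{a,b}u_{ab}|a\rangle\langle b|$ is $\mathbf U=\sum_{a,b}u_{ab}|\mathbf a\rangle\langle\mathbf b|$. The encoded family $\boldsymbol\Psi$ consists of the states $|\boldsymbol\psi_i\rangle$ on $\mathbf E_i=\bigcup_{l\in E_i}B_l$. An LOCC protocol is an adaptive finite sequence of generalized measurements, each given by finitely many Kraus operators $K_j$ with $\sum_j K_j^\dagger K_j=1$ on a single physical qubit. **Theorem.** Let $\Psi$ be a universal resource under local projective measurements, up to local unitary operations. Then for every $m$-qubit encoding $\{|\mathbf 0\rangle,|\mathbf 1\rangle\}$ (and every choice of the pairwise disjoint blocks $B_l$) the encoded family $\boldsymbol\Psi$ is an encoded universal resource under LOCC on the physical qubits, up to logical local unitary operations, with respect to this encoding. That is, for every $n$ and every normalized $n$-qubit state $|\phi\rangle$ there are an index $i$, $n$ distinct blocks $B_{l_1},\dots,B_{l_n}$ with $l_1,\dots,l_n\in E_i$, and an LOCC protocol on $|\boldsymbol\psi_i\rangle$, such that in every branch $\alpha$ of non-zero probability the final state is, up to normalization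 and phase, $$\bigl(\mathbf U^\alpha_1\otimes\dots\otimes\mathbf U^\alpha_n\bigr)|\boldsymbol\phi\rangle^{B_{l_1}\cdots B_{l_n}}\;|0\rangle^{\text{all other physical qubits}}$$ for some one-qubit unitaries $U^\alpha_1,\dots,U^\alpha_n$ with encoded versions $\mathbf U^\alpha_k$; the blocks $B_{l_1},\dots,B_{l_n}$ are the same in all branches. -/

import Mathlib

/-- State vectors of a system of qubits labelled by `V`: amplitudes in the computational basis,
which is indexed by the bit strings `V → Fin 2`. -/
abbrev QState (V : Type*) := EuclideanSpace ℂ (V → Fin 2)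

section Operations

variable {V W : Type*} [Fintype V] [DecidableEq V] [Fintype W] [DecidableEq W]

/-- The one-qubit operator `K` acting on qubit `v`, identity on all the other qubits. -/
noncomputable def applyAt (v : V) (K : Matrix (Fin 2) (Fin 2) ℂ) (ψ : QState V) : QState V :=
  WithLp.toLp 2 fun x => ∑ b, K (x v) b * ψ (Function.update x v b)

/-- The product operator `⨂ v, U v`. -/
noncomputable def localOp (U : V → Matrix (Fin 2) (Fin 2) ℂ) (ψ : QState V) : QState V :=
  WithLp.toLp 2 fun x => ∑ y, (∏ v, U v (x v) (y v)) * ψ y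

open Classical in
/-- `|φ⟩^A |0⟩^Ā`: the state `φ` on the qubits `A = range e` (qubit `w` of `φ` sits at `e w`),
every other qubit being in the state `|0⟩`. -/
noncomputable def placeState (e : W ↪ V) (φ : QState W) : QState V :=
  WithLp.toLp 2 fun x => if ∀ v, v ∉ Set.range e → x v = 0 then φ (fun w => x (e w)) else 0

end Operations

/-- The projector `|a⟩⟨a|` onto a one-qubit vector. -/
noncomputable def ketBra (a : EuclideanSpace ℂ (Fin 2)) : Matrix (Fin 2) (Fin 2) ℂ :=
  Matrix.of fun r s => a r * star (a s)

/-- Adaptive sequences of single-qubit projective measurements: stop, or measure qubit `v` in the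
orthonormal basis `b` and continue in a way that may depend on the outcome. -/
inductive MeasurementProtocol (V : Type*)
  | done : MeasurementProtocol V
  | measure (v : V) (b : OrthonormalBasis (Fin 2) ℂ (EuclideanSpace ℂ (Fin 2)))
      (next : Fin 2 → MeasurementProtocol V) : MeasurementProtocol V

/-- LOCC protocols in which every qubit is a separate party: stop, or perform on qubit `v` a
generalized measurement with finitely many Kraus operators `K i`, `∑ i, (K i)† K i = 1`, and
continue in a way that may depend on the (communicated) outcome. -/
inductive LOCCProtocol (V : Type*)
  | done : LOCCProtocol V
  | step (v : V) (k : ℕ) (K : Fin k → Matrix (Fin 2) (Fin 2) ℂ)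
      (complete : ∑ i, (K i).conjTranspose * K i = 1)
      (next : Fin k → LOCCProtocol V) : LOCCProtocol V

/-- The final (unnormalized) states of all the branches of the protocol satisfy `P`. The squared
norm of the final state of a branch is the probability of that branch. -/
def MeasurementProtocol.AllBranches {V : Type*} [DecidableEq V] (P : QState V → Prop) :
    MeasurementProtocol V → QState V → Prop
  | .done, ψ => P ψ
  | .measure v b next, ψ => ∀ i, (next i).AllBranches P (applyAt v (ketBra (b i)) ψ)

/-- The final (unnormalized) states of all the branches of the protocol satisfy `P`. The squared
norm of the final state of a branch is the probability of that branch. -/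
def LOCCProtocol.AllBranches {V : Type*} [DecidableEq V] (P : QState V → Prop) :
    LOCCProtocol V → QState V → Prop
  | .done, ψ => P ψ
  | .step v _ K _ next, ψ => ∀ i, (next i).AllBranches P (applyAt v (K i) ψ)

/-- A family of states `|ψ_0⟩, |ψ_1⟩, …`, where `|ψ_i⟩` is a normalized state on a finite set of
qubits `qubits i`, these sets being nested. -/
structure ResourceFamily (Q : Type*) [DecidableEq Q] where
  qubits : ℕ → Finset Q
  mono : Monotone qubits
  state : ∀ i, QState (qubits i)
  norm_state : ∀ i, ‖state i‖ = 1

/-- Every `n`-qubit state `φ` can be prepared, with unit probability and on the same output qubits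
in all branches, from some member of the family by local projective measurements, up to local
unitaries (which may depend on the branch): each branch ends in a multiple of
`(⨂ v, U v) |φ⟩^A |0⟩^Ā`, branches of probability zero giving the multiple `0`. -/
def ResourceFamily.IsUniversalByMeasurements {Q : Type*} [DecidableEq Q]
    (Ψ : ResourceFamily Q) : Prop :=
  ∀ (n : ℕ) (φ : QState (Fin n)), ‖φ‖ = 1 →
    ∃ (i : ℕ) (e : Fin n ↪ Ψ.qubits i) (p : MeasurementProtocol (Ψ.qubits i)),
      p.AllBranches
        (fun χ => ∃ (c : ℂ) (U : Ψ.qubits i → Matrix.unitaryGroup (Fin 2) ℂ),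
          χ = c • localOp (fun v => (U v : Matrix (Fin 2) (Fin 2) ℂ)) (placeState e φ))
        (Ψ.state i)

/-- An `m`-qubit encoding of one qubit: two orthogonal normalized `m`-qubit states, the logical
basis states. -/
structure QubitCode (m : ℕ) where
  ket : Fin 2 → QState (Fin m)
  orthonormal : Orthonormal ℂ ket

namespace QubitCode

variable {m : ℕ} (C : QubitCode m) {W : Type*} [Fintype W] [DecidableEq W]

/-- The encoded version of a state on the qubits `W`; the logical qubit `w` consists of the
physical qubits `(w, j)`, `j : Fin m`. -/
noncomputable def encode (φ : QState W) : QState (W × Fin m) :=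
  WithLp.toLp 2 fun x => ∑ y, φ y * ∏ w, C.ket (y w) (fun j => x (w, j))

/-- The encoded version `∑ a b, U a b |a_L⟩⟨b_L|` of a one-qubit operator `U`. -/
noncomputable def logicalMatrix (U : Matrix (Fin 2) (Fin 2) ℂ) :
    Matrix (Fin m → Fin 2) (Fin m → Fin 2) ℂ :=
  Matrix.of fun x y => ∑ a, ∑ b, U a b * (C.ket a x * star (C.ket b y))

/-- The logical local operator `⨂ w, U_L w`, where `U_L w` is the encoded version of `U w` and
acts on the block of physical qubits `(w, j)`, `j : Fin m`. -/
noncomputable def logicalLocalOp (U : W → Matrix (Fin 2) (Fin 2) ℂ) (ψ : QState (W × Fin m)) :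
    QState (W × Fin m) :=
  WithLp.toLp 2 fun x =>
    ∑ y, (∏ w, C.logicalMatrix (U w) (fun j => x (w, j)) (fun j => y (w, j))) * ψ y

lemma sum_star_ket_mul_ket (a b : Fin 2) :
    ∑ x, star (C.ket a x) * C.ket b x = if a = b then 1 else 0 := by
  have h := orthonormal_iff_ite.mp C.orthonormal a b
  rw [← h, PiLp.inner_apply]
  exact Finset.sum_congr rfl fun x _ => by simp [mul_comm]

lemma sum_prod_blocks (f : W → (Fin m → Fin 2) → ℂ) :
    ∑ x : W × Fin m → Fin 2, ∏ w, f w (fun j => x (w, j)) = ∏ w, ∑ u, f w u := by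
  rw [Finset.prod_univ_sum, Fintype.piFinset_univ]
  exact Fintype.sum_equiv (Equiv.curry W (Fin m) (Fin 2)) _ _ fun x => rfl

lemma sum_blocks_star_ket_mul_ket (y z : W → Fin 2) :
    ∑ x : W × Fin m → Fin 2, (∏ w, star (C.ket (y w) (fun j => x (w, j)))) *
      ∏ w, C.ket (z w) (fun j => x (w, j)) = if y = z then 1 else 0 := by
  simp_rw [← Finset.prod_mul_distrib]
  rw [sum_prod_blocks fun w u => star (C.ket (y w) u) * C.ket (z w) u]
  simp_rw [sum_star_ket_mul_ket]
  rw [Finset.prod_ite_zero]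
  simp [funext_iff]

lemma norm_encode (φ : QState W) : ‖C.encode φ‖ = ‖φ‖ := by
  have h : inner ℂ (C.encode φ) (C.encode φ) = inner ℂ φ φ := by
    simp only [PiLp.inner_apply, RCLike.inner_apply, encode, map_sum, map_mul, map_prod,
      Finset.sum_mul_sum]
    rw [Finset.sum_comm]
    refine Finset.sum_congr rfl fun y _ => ?_
    rw [Finset.sum_comm]
    have key : ∀ z : W → Fin 2, ∑ x : W × Fin m → Fin 2,
        φ y * (∏ w, C.ket (y w) fun j => x (w, j)) * ((starRingEnd ℂ) (φ z) *
          ∏ w, (starRingEnd ℂ) (C.ket (z w) fun j => x (w, j)))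
        = if z = y then φ y * (starRingEnd ℂ) (φ z) else 0 := by
      intro z
      have := C.sum_blocks_star_ket_mul_ket z y
      rw [← mul_one (φ y * (starRingEnd ℂ) (φ z)), ← mul_zero (φ y * (starRingEnd ℂ) (φ z)),
        ← mul_ite, ← this, Finset.mul_sum]
      refine Finset.sum_congr rfl fun x _ => ?_
      simp only [Complex.star_def]
      ring
    simp_rw [key]
    simp
  have h2 : (‖C.encode φ‖ : ℂ) ^ 2 = (‖φ‖ : ℂ) ^ 2 := by
    simpa [inner_self_eq_norm_sq_to_K] using h
  exact (sq_eq_sq₀ (norm_nonneg _) (norm_nonneg _)).mp (by exact_mod_cast h2)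

/-- Logical local operators act on encoded states as the local operators act on the states. -/
lemma logicalLocalOp_encode (U : W → Matrix (Fin 2) (Fin 2) ℂ) (φ : QState W) :
    C.logicalLocalOp U (C.encode φ) = C.encode (localOp U φ) := by
  have block (A : Matrix (Fin 2) (Fin 2) ℂ) (z : Fin 2) (u : Fin m → Fin 2) :
      ∑ t, C.logicalMatrix A u t * C.ket z t = ∑ a, A a z * C.ket a u := by
    simp only [logicalMatrix, Matrix.of_apply, Finset.sum_mul]
    rw [Finset.sum_comm]
    refine Finset.sum_congr rfl fun a _ => ?_
    rw [Finset.sum_comm]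
    simp_rw [mul_assoc, ← Finset.mul_sum, sum_star_ket_mul_ket]
    simp
  ext x
  simp only [logicalLocalOp, encode, localOp, Finset.mul_sum, Finset.sum_mul]
  rw [Finset.sum_comm]
  conv_rhs => rw [Finset.sum_comm]
  refine Finset.sum_congr rfl fun z _ => ?_
  have h1 : ∀ y : W × Fin m → Fin 2,
      (∏ w, C.logicalMatrix (U w) (fun j => x (w, j)) (fun j => y (w, j))) *
        (φ z * ∏ w, C.ket (z w) (fun j => y (w, j)))
      = φ z * ∏ w, (C.logicalMatrix (U w) (fun j => x (w, j)) (fun j => y (w, j)) *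
          C.ket (z w) (fun j => y (w, j))) := by
    intro y; rw [Finset.prod_mul_distrib]; ring
  simp_rw [h1]
  rw [← Finset.mul_sum, sum_prod_blocks fun w t =>
    C.logicalMatrix (U w) (fun j => x (w, j)) t * C.ket (z w) t]
  simp_rw [block]
  rw [Finset.prod_univ_sum, Fintype.piFinset_univ, Finset.mul_sum]
  refine Finset.sum_congr rfl fun y _ => ?_
  rw [Finset.prod_mul_distrib]
  ring

end QubitCode

lemma norm_placeState {V W : Type*} [Fintype V] [DecidableEq V] [Fintype W] [DecidableEq W]
    (e : W ↪ V) (φ : QState W) : ‖placeState e φ‖ = ‖φ‖ := by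
  classical
  rw [EuclideanSpace.norm_eq, EuclideanSpace.norm_eq]
  congr 1
  symm
  refine Finset.sum_of_injOn (fun y => Function.extend e y 0) ?_ (by simp) ?_ ?_
  · intro y _ z _ h
    funext w
    simpa [e.injective.extend_apply] using congrFun h (e w)
  · intro x _ hx
    have : ¬ ∀ v, v ∉ Set.range e → x v = 0 := by
      intro h
      refine hx ⟨fun w => x (e w), by simp, ?_⟩
      funext v
      by_cases hv : v ∈ Set.range e
      · obtain ⟨w, rfl⟩ := hv
        exact e.injective.extend_apply _ _ w
      · dsimp only
        rw [Function.extend_apply' _ _ _ (by simpa using hv), h v hv]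
        rfl
    simp only [placeState]
    rw [if_neg this]
    simp
  · intro y _
    have h : ∀ v, v ∉ Set.range e → Function.extend e y 0 v = 0 := fun v hv => by
      rw [Function.extend_apply' _ _ _ (by simpa using hv)]
      rfl
    simp only [placeState]
    rw [if_pos h]
    simp [e.injective.extend_apply]

/-- A consistent family of `m`-qubit encodings for a family of states: a code; for every `i` a set
`logical i` of logical qubits; and a layout `block`, the logical qubit `l` consisting of the
physical qubits `block (l, j)`, `j : Fin m`. The blocks of the logical qubits in `logical i`
partition `qubits i`, and these partitions are nested. -/
structure ConsistentEncodings {Q : Type*} [DecidableEq Q] (Ψ : ResourceFamily Q)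
    (L : Type*) (m : ℕ) where
  code : QubitCode m
  logical : ℕ → Finset L
  mono : Monotone logical
  block : L × Fin m ↪ Q
  qubits_eq : ∀ i, Ψ.qubits i = (logical i ×ˢ Finset.univ).map block

/-- The position, among the physical qubits with index `i`, of the physical qubits of the logical
qubits `e w`. -/
def ConsistentEncodings.position {Q : Type*} [DecidableEq Q] {Ψ : ResourceFamily Q}
    {L : Type*} {m : ℕ} (ℰ : ConsistentEncodings Ψ L m) {i : ℕ} {W : Type*}
    (e : W ↪ ℰ.logical i) : W × Fin m ↪ Ψ.qubits i where
  toFun p := ⟨ℰ.block ((e p.1 : L), p.2), by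
    rw [ℰ.qubits_eq i]
    exact Finset.mem_map_of_mem _ (by simp)⟩
  inj' p q h := by
    have h' := ℰ.block.injective (Subtype.ext_iff.mp h)
    rw [Prod.mk.injEq] at h'
    exact Prod.ext (e.injective (Subtype.ext h'.1)) h'.2

/-- The family is an encoded universal resource under LOCC on the physical qubits, with respect to
the given encodings, up to logical local unitaries: from some member of the family, the encoded
version of any `n`-qubit state `φ` can be prepared with unit probability, on the same `n` logical
qubits in all branches and with all other physical qubits in the state `|0⟩`, up to a logical local
unitary that may depend on the branch. -/
def ConsistentEncodings.IsEncodedUniversal {Q : Type*} [DecidableEq Q] {Ψ : ResourceFamily Q}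
    {L : Type*} {m : ℕ} (ℰ : ConsistentEncodings Ψ L m) : Prop :=
  ∀ (n : ℕ) (φ : QState (Fin n)), ‖φ‖ = 1 →
    ∃ (i : ℕ) (e : Fin n ↪ ℰ.logical i) (p : LOCCProtocol (Ψ.qubits i)),
      p.AllBranches
        (fun χ => ∃ (c : ℂ) (U : Fin n → Matrix.unitaryGroup (Fin 2) ℂ),
          χ = c • placeState (ℰ.position e)
            (ℰ.code.logicalLocalOp (fun k => (U k : Matrix (Fin 2) (Fin 2) ℂ))
              (ℰ.code.encode φ)))
        (Ψ.state i)

section EncodedFamily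

variable {L Q : Type*} [DecidableEq L] [DecidableEq Q] {m : ℕ}

/-- The bijection from the physical qubits of the logical qubits in `S` to the set of all those
physical qubits. -/
def physicalPosition (block : L × Fin m ↪ Q) (S : Finset L) :
    S × Fin m ↪ ((S ×ˢ Finset.univ).map block : Finset Q) where
  toFun p := ⟨block ((p.1 : L), p.2), Finset.mem_map_of_mem _ (by simp)⟩
  inj' p q h := by
    have h' := block.injective (Subtype.ext_iff.mp h)
    rw [Prod.mk.injEq] at h'
    exact Prod.ext (Subtype.ext h'.1) h'.2

/-- The encoded version of a family of states: the qubit `l` of each member becomes a logical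
qubit, realized by the physical qubits `block (l, j)`, `j : Fin m`. -/
noncomputable def ResourceFamily.encoded (Ψ : ResourceFamily L) (C : QubitCode m)
    (block : L × Fin m ↪ Q) : ResourceFamily Q where
  qubits i := (Ψ.qubits i ×ˢ Finset.univ).map block
  mono i j h := Finset.map_subset_map.mpr (Finset.product_subset_product_left (Ψ.mono h))
  state i := placeState (physicalPosition block (Ψ.qubits i)) (C.encode (Ψ.state i))
  norm_state i := by rw [norm_placeState, QubitCode.norm_encode, Ψ.norm_state]

/-- The encodings with respect to which `Ψ.encoded C block` is the encoded version of `Ψ`. -/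
noncomputable def ResourceFamily.encodings (Ψ : ResourceFamily L) (C : QubitCode m)
    (block : L × Fin m ↪ Q) : ConsistentEncodings (Ψ.encoded C block) L m where
  code := C
  logical := Ψ.qubits
  mono := Ψ.mono
  block := block
  qubits_eq _ := rfl

end EncodedFamily

open Matrix

/-! A projective measurement of a logical qubit distinguishes two orthogonal states of its block. By
the argument of Walgate et al. this can be done qubit by qubit. At each physical qubit, a matrix
whose trace is the overlap of the two states is brought to zero diagonal by a unitary
(`exists_unitary_diag_eq_zero`), and measuring in the corresponding basis keeps the states
orthogonal for every outcome. When all qubits are read, at most one of the two states has non-zero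
amplitude, so the logical qubit has been projected (`canPrepare_of_distinguish`). Each Kraus
operator also resets its qubit to `|0⟩`.

Such a measurement destroys the block. A later measurement of the same logical qubit needs no
physical action: its state is known, and any outcome of non-zero amplitude can be declared
(`canPrepare_of_simulation`).

The output qubits, however, must still be encoded at the end, and a protocol preparing `φ` might
have measured them. It is therefore made to prepare `entangledState φ`, the sum over the identity, X
and Z of the Pauli images of `φ`, tagged by weight-one strings of three auxiliary qubits. No qubit
of this state factorizes, whereas a measured qubit does, so the output blocks were never touched
(`Tracks.eq_toMatrix`). Measuring all other blocks that are still encoded leaves one Pauli image of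
`φ`, and the Pauli is absorbed into the logical local unitary (`canPrepare_of_entangledState`). -/

/-- The target property `P` can be reached from `ψ` with unit probability by some LOCC protocol. -/
def CanPrepare {V : Type*} [DecidableEq V] (P : QState V → Prop) (ψ : QState V) : Prop :=
  ∃ p : LOCCProtocol V, p.AllBranches P ψ

lemma CanPrepare.of_done {V : Type*} [DecidableEq V] {P : QState V → Prop} {ψ : QState V}
    (h : P ψ) : CanPrepare P ψ := ⟨.done, h⟩

lemma CanPrepare.of_step {V : Type*} [DecidableEq V] {P : QState V → Prop} {ψ : QState V}
    (v : V) {k : ℕ} (K : Fin k → Matrix (Fin 2) (Fin 2) ℂ) (hK : ∑ i, (K i)ᴴ * K i = 1)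
    (h : ∀ i, CanPrepare P (applyAt v (K i) ψ)) : CanPrepare P ψ := by
  choose p hp using h
  exact ⟨.step v k K hK p, hp⟩

/-! ### Traceless `2 × 2` matrices and zero diagonals -/

lemma exists_unit_orthogonal (α β : ℝ) : ∃ p q : ℝ, p ^ 2 + q ^ 2 = 1 ∧ α * p + β * q = 0 := by
  by_cases h : α ^ 2 + β ^ 2 = 0
  · have hα : α = 0 := by nlinarith [sq_nonneg α, sq_nonneg β]
    have hβ : β = 0 := by nlinarith [sq_nonneg α, sq_nonneg β]
    exact ⟨1, 0, by norm_num, by simp [hα, hβ]⟩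
  · have hs : √(α ^ 2 + β ^ 2) ^ 2 = α ^ 2 + β ^ 2 := Real.sq_sqrt (by positivity)
    have h0 : √(α ^ 2 + β ^ 2) ≠ 0 := fun h0 => h (by rw [← hs, h0]; norm_num)
    refine ⟨β / √(α ^ 2 + β ^ 2), -α / √(α ^ 2 + β ^ 2), ?_, ?_⟩
    · rw [div_pow, div_pow, hs]
      field_simp
      ring
    · ring

/-- With `s = t * c` the second condition becomes `t ^ 2 - r * t - 1 = 0`, whose discriminant `r ^ 2
+ 4` is positive. -/
lemma exists_unit_isotropic (r : ℝ) :
    ∃ c s : ℝ, c ^ 2 + s ^ 2 = 1 ∧ c ^ 2 - s ^ 2 + r * (c * s) = 0 := by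
  have hr : √(r ^ 2 + 4) ^ 2 = r ^ 2 + 4 := Real.sq_sqrt (by positivity)
  obtain ⟨t, h1⟩ : ∃ t : ℝ, t ^ 2 - r * t - 1 = 0 :=
    ⟨(r + √(r ^ 2 + 4)) / 2, by linear_combination hr / 4⟩
  have hs : √(1 + t ^ 2) ^ 2 = 1 + t ^ 2 := Real.sq_sqrt (by positivity)
  have h0 : 1 + t ^ 2 ≠ 0 := by positivity
  refine ⟨1 / √(1 + t ^ 2), t / √(1 + t ^ 2), ?_, ?_⟩
  · rw [div_pow, div_pow, hs]
    field_simp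
  · rw [div_mul_div_comm, ← sq, div_pow, div_pow, hs]
    field_simp
    linear_combination -h1

/-- A traceless `2 × 2` matrix is unitarily similar to one with zero diagonal. -/
lemma exists_unitary_diag_eq_zero (M : Matrix (Fin 2) (Fin 2) ℂ) (hM : M.trace = 0) :
    ∃ W : Matrix (Fin 2) (Fin 2) ℂ, Wᴴ * W = 1 ∧ ∀ i, (Wᴴ * M * W) i i = 0 := by
  -- The first column of `W` will be `(c, z * s)` with `z` a phase. For `M 1 1 = -M 0 0` the
  -- equation says that the first diagonal entry of `Wᴴ * M * W` vanishes; the second is its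
  -- negative.
  have key : ∃ (c s : ℝ) (z : ℂ), c ^ 2 + s ^ 2 = 1 ∧ star z * z = 1 ∧
      M 0 0 * (c ^ 2 - s ^ 2) + c * s * (M 0 1 * z + M 1 0 * star z) = 0 := by
    by_cases ha : M 0 0 = 0
    · exact ⟨1, 0, 1, by norm_num, by simp, by simp [ha]⟩
    -- The phase `z = p + q * I` makes `(M 0 1 * z + M 1 0 * star z) / M 0 0` real, so that the
    -- equation for `c` and `s` is a real one.
    obtain ⟨p, q, hpq, h⟩ := exists_unit_orthogonal ((M 0 1 + M 1 0) / M 0 0).im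
      (Complex.I * (M 0 1 - M 1 0) / M 0 0).im
    have hz : ((M 0 1 * (p + q * Complex.I) + M 1 0 * (p - q * Complex.I)) / M 0 0).im = 0 := by
      rw [← h]
      have : (M 0 1 * (p + q * Complex.I) + M 1 0 * (p - q * Complex.I)) / M 0 0
        = p * ((M 0 1 + M 1 0) / M 0 0) + q * (Complex.I * (M 0 1 - M 1 0) / M 0 0) := by ring
      rw [this, Complex.add_im, Complex.im_ofReal_mul, Complex.im_ofReal_mul]
      ring
    obtain ⟨c, s, hcs, h'⟩ := exists_unit_isotropic
      ((M 0 1 * (p + q * Complex.I) + M 1 0 * (p - q * Complex.I)) / M 0 0).re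
    have hr : ((((M 0 1 * (p + q * Complex.I) + M 1 0 * (p - q * Complex.I)) / M 0 0).re : ℝ) : ℂ)
        = (M 0 1 * (p + q * Complex.I) + M 1 0 * (p - q * Complex.I)) / M 0 0 :=
      Complex.ext (by simp) (by rw [hz]; simp)
    have hstar : star ((p : ℂ) + q * Complex.I) = p - q * Complex.I := by
      simp [sub_eq_add_neg]
    refine ⟨c, s, p + q * Complex.I, hcs, ?_, ?_⟩
    · rw [hstar]
      have : ((p : ℂ)) ^ 2 + (q : ℂ) ^ 2 = 1 := by exact_mod_cast hpq
      linear_combination this - (q : ℂ) ^ 2 * Complex.I_sq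
    · have h2 : (c : ℂ) ^ 2 - (s : ℂ) ^ 2
          + (M 0 1 * (p + q * Complex.I) + M 1 0 * (p - q * Complex.I)) / M 0 0 * (c * s) = 0 := by
        rw [← hr]
        exact_mod_cast h'
      rw [hstar]
      field_simp at h2
      linear_combination h2
  obtain ⟨c, s, z, hcs, hz, h⟩ := key
  have hcs' : ((c : ℂ)) ^ 2 + (s : ℂ) ^ 2 = 1 := by exact_mod_cast hcs
  have htr : M 1 1 = - M 0 0 := by
    rw [Matrix.trace_fin_two] at hM
    linear_combination hM
  refine ⟨!![(c : ℂ), -s; z * s, z * c], ?_, ?_⟩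
  · ext i j
    rw [Matrix.mul_apply, Fin.sum_univ_two]
    simp only [Matrix.conjTranspose_apply]
    fin_cases i <;> fin_cases j <;> simp at hz ⊢
    · linear_combination hcs' + (s : ℂ) ^ 2 * hz
    · linear_combination (s * c : ℂ) * hz
    · linear_combination (s * c : ℂ) * hz
    · linear_combination hcs' + (c : ℂ) ^ 2 * hz
  · intro i
    simp only [Matrix.mul_apply, Fin.sum_univ_two, Matrix.conjTranspose_apply, htr]
    fin_cases i <;> simp at hz h ⊢
    · linear_combination h - M 0 0 * (s : ℂ) ^ 2 * hz
    · linear_combination -h - M 0 0 * (c : ℂ) ^ 2 * hz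

lemma applyAt_one_sub {W : Type*} [DecidableEq W] (v : W) (K : Matrix (Fin 2) (Fin 2) ℂ) (ψ : QState W) :
    applyAt v (1 - K) ψ = ψ - applyAt v K ψ := by
  ext x
  simp [applyAt, Matrix.one_apply, sub_mul, Finset.sum_sub_distrib]

/-! ### Product maps and their composition with one-qubit operators -/

section ProductMaps

variable {W V : Type*} [Fintype W] [DecidableEq W] {α : Type*}

/-- The product map `⨂ w, T w` between systems of different local dimensions. -/
noncomputable def prodMap (T : W → Matrix α (Fin 2) ℂ) (ψ : QState W) (x : W → α) : ℂ :=
  ∑ y, (∏ w, T w (x w) (y w)) * ψ y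

lemma localOp_eq_prodMap (U : W → Matrix (Fin 2) (Fin 2) ℂ) (ψ : QState W) :
    localOp U ψ = WithLp.toLp 2 (prodMap U ψ) := rfl

lemma prodMap_localOp (T : W → Matrix α (Fin 2) ℂ) (U : W → Matrix (Fin 2) (Fin 2) ℂ)
    (ψ : QState W) : prodMap T (localOp U ψ) = prodMap (fun w => T w * U w) ψ := by
  funext x
  simp only [prodMap, localOp, Matrix.mul_apply, Finset.prod_univ_sum, Fintype.piFinset_univ,
    Finset.mul_sum, Finset.sum_mul, Finset.prod_mul_distrib]
  rw [Finset.sum_comm]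
  exact Finset.sum_congr rfl fun _ _ => Finset.sum_congr rfl fun _ _ => by ring

lemma localOp_localOp (T U : W → Matrix (Fin 2) (Fin 2) ℂ) (ψ : QState W) :
    localOp T (localOp U ψ) = localOp (fun w => T w * U w) ψ := by
  rw [localOp_eq_prodMap, prodMap_localOp, localOp_eq_prodMap]

lemma prodMap_smul (T : W → Matrix α (Fin 2) ℂ) (c : ℂ) (ψ : QState W) :
    prodMap T (c • ψ) = c • prodMap T ψ := by
  funext x
  simp only [prodMap, PiLp.smul_apply, smul_eq_mul, Pi.smul_apply, Finset.mul_sum]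
  exact Finset.sum_congr rfl fun _ _ => by ring

lemma localOp_smul (T : W → Matrix (Fin 2) (Fin 2) ℂ) (c : ℂ) (ψ : QState W) :
    localOp T (c • ψ) = c • localOp T ψ := by
  rw [localOp_eq_prodMap, prodMap_smul]
  rfl

lemma localOp_one (ψ : QState W) : localOp (fun _ => 1) ψ = ψ := by
  ext x
  simp only [localOp, Matrix.one_apply, Finset.prod_ite_zero]
  simp [← funext_iff]

lemma applyAt_eq_localOp (v : W) (K : Matrix (Fin 2) (Fin 2) ℂ) (ψ : QState W) :
    applyAt v K ψ = localOp (Function.update (fun _ => 1) v K) ψ := by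
  ext x
  simp only [applyAt, localOp]
  refine Finset.sum_of_injOn (fun b => Function.update x v b) ?_ (by simp) ?_ ?_
  · intro b _ c _ h
    simpa using congrFun h v
  · intro y _ hy
    obtain ⟨w, hwv, hw⟩ : ∃ w, w ≠ v ∧ x w ≠ y w := by
      by_contra! h
      refine hy ⟨y v, by simp, ?_⟩
      funext w
      by_cases hw : w = v
      · subst hw; simp
      · simp [hw, h w hw]
    rw [Finset.prod_eq_zero (Finset.mem_univ w), zero_mul]
    simp [hwv, hw]
  · intro b _
    rw [Finset.prod_eq_single v]
    · simp
    · intro w _ hw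
      simp [hw]
    · simp

lemma prodMap_applyAt (T : W → Matrix α (Fin 2) ℂ) (v : W) (K : Matrix (Fin 2) (Fin 2) ℂ)
    (ψ : QState W) :
    prodMap T (applyAt v K ψ) = prodMap (Function.update T v (T v * K)) ψ := by
  rw [applyAt_eq_localOp, prodMap_localOp]
  congr 1
  funext w
  by_cases hw : w = v
  · subst hw; simp
  · simp [hw]

lemma applyAt_comm {v w : W} (h : v ≠ w) (K K' : Matrix (Fin 2) (Fin 2) ℂ) (ψ : QState W) :
    applyAt v K (applyAt w K' ψ) = applyAt w K' (applyAt v K ψ) := by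
  simp only [applyAt_eq_localOp, localOp_localOp]
  congr 1
  funext u
  by_cases hv : u = v
  · subst hv; simp [h]
  · by_cases hw : u = w
    · subst hw; simp [hv]
    · simp [hv, hw]

lemma applyAt_applyAt (v : W) (K K' : Matrix (Fin 2) (Fin 2) ℂ) (ψ : QState W) :
    applyAt v K (applyAt v K' ψ) = applyAt v (K * K') ψ := by
  simp only [applyAt_eq_localOp, localOp_localOp]
  congr 1
  funext u
  by_cases hv : u = v
  · subst hv; simp
  · simp [hv]

variable {m : ℕ} (e : W × Fin m ≃ V)

/-- The image of `ψ` under `⨂ w, T w`, where `T w` maps the qubit `w` to the block of qubits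
`e (w, j)`, `j : Fin m`. -/
noncomputable def blockState (T : W → Matrix (Fin m → Fin 2) (Fin 2) ℂ) (ψ : QState W) : QState V :=
  WithLp.toLp 2 fun x => prodMap T ψ fun w j => x (e (w, j))

lemma blockState_applyAt (T : W → Matrix (Fin m → Fin 2) (Fin 2) ℂ) (v : W)
    (K : Matrix (Fin 2) (Fin 2) ℂ) (ψ : QState W) :
    blockState e T (applyAt v K ψ) = blockState e (Function.update T v (T v * K)) ψ := by
  simp only [blockState, prodMap_applyAt]

lemma blockState_localOp (T : W → Matrix (Fin m → Fin 2) (Fin 2) ℂ)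
    (U : W → Matrix (Fin 2) (Fin 2) ℂ) (ψ : QState W) :
    blockState e T (localOp U ψ) = blockState e (fun w => T w * U w) ψ := by
  simp only [blockState, prodMap_localOp]

lemma blockState_smul (T : W → Matrix (Fin m → Fin 2) (Fin 2) ℂ) (c : ℂ) (ψ : QState W) :
    blockState e T (c • ψ) = c • blockState e T ψ := by
  simp only [blockState, prodMap_smul]
  rfl

/-- The operator `K` on qubit `j` of a block, composed with a map into the block. -/
noncomputable def onQubit (j : Fin m) (K : Matrix (Fin 2) (Fin 2) ℂ)
    (T : Matrix (Fin m → Fin 2) (Fin 2) ℂ) : Matrix (Fin m → Fin 2) (Fin 2) ℂ :=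
  Matrix.of fun u y => ∑ s, K (u j) s * T (Function.update u j s) y

/-- The physical counterpart of `blockState_applyAt`: a physical operation changes only the map of
its own block, so a whole protocol can be followed through `T` while `ψ` is kept as the logical
state. -/
lemma applyAt_blockState [DecidableEq V] (T : W → Matrix (Fin m → Fin 2) (Fin 2) ℂ) (w : W) (j : Fin m)
    (K : Matrix (Fin 2) (Fin 2) ℂ) (ψ : QState W) :
    applyAt (e (w, j)) K (blockState e T ψ)
      = blockState e (Function.update T w (onQubit j K (T w))) ψ := by
  ext x
  simp only [applyAt, blockState, prodMap, Finset.mul_sum]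
  rw [Finset.sum_comm]
  refine Finset.sum_congr rfl fun y _ => ?_
  rw [Fintype.prod_eq_mul_prod_compl w]
  have h : ∀ b, ∏ w', T w' (fun i => Function.update x (e (w, j)) b (e (w', i))) (y w')
      = T w (Function.update (fun i => x (e (w, i))) j b) (y w) *
        ∏ w' ∈ {w}ᶜ, T w' (fun i => x (e (w', i))) (y w') := by
    intro b
    rw [Fintype.prod_eq_mul_prod_compl w]
    congr 1
    · congr 1
      funext i
      simp [Function.update_apply]
    · refine Finset.prod_congr rfl fun w' hw' => ?_
      have hw : w' ≠ w := by simpa using hw'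
      congr 1
      funext i
      rw [Function.update_of_ne]
      simp [hw]
  have h' : ∏ w' ∈ {w}ᶜ, Function.update T w (onQubit j K (T w)) w' (fun i => x (e (w', i))) (y w')
      = ∏ w' ∈ {w}ᶜ, T w' (fun i => x (e (w', i))) (y w') := by
    refine Finset.prod_congr rfl fun w' hw' => ?_
    have hw : w' ≠ w := by simpa using hw'
    simp [hw]
  rw [h']
  simp only [h, onQubit, Function.update_self, Matrix.of_apply, Finset.sum_mul]
  exact Finset.sum_congr rfl fun _ _ => by ring

end ProductMaps

/-! ### Local discrimination of two orthogonal block states -/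

section OneQubitOperators

/-- The operator `|0⟩⟨a|`. -/
def resetOp (a : Fin 2 → ℂ) : Matrix (Fin 2) (Fin 2) ℂ :=
  Matrix.of fun r s => if r = 0 then star (a s) else 0

lemma sum_resetOp (W : Matrix (Fin 2) (Fin 2) ℂ) (hW : Wᴴ * W = 1) :
    ∑ i, (resetOp fun s => W s i)ᴴ * resetOp (fun s => W s i) = 1 := by
  rw [← mul_eq_one_comm.mp hW]
  ext r s
  simp [Matrix.sum_apply, Matrix.mul_apply, resetOp]

end OneQubitOperators

section Distinguish

variable {m : ℕ}

/-- The map `|0…0⟩⟨η|` from a qubit to a block of `m` qubits, `η` being given as a row vector. -/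
def resetBlock (m : ℕ) (η : Fin 2 → ℂ) : Matrix (Fin m → Fin 2) (Fin 2) ℂ :=
  Matrix.of fun u y => if u = 0 then η y else 0

lemma resetBlock_mul (η : Fin 2 → ℂ) (K : Matrix (Fin 2) (Fin 2) ℂ) :
    resetBlock m η * K = resetBlock m (η ᵥ* K) := by
  ext u y
  by_cases hu : u = 0 <;> simp [resetBlock, Matrix.mul_apply, Matrix.vecMul, dotProduct, hu]

lemma onQubit_mul (j : Fin m) (K B : Matrix (Fin 2) (Fin 2) ℂ)
    (T : Matrix (Fin m → Fin 2) (Fin 2) ℂ) : onQubit j K T * B = onQubit j K (T * B) := by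
  ext u y
  simp only [onQubit, Matrix.mul_apply, Matrix.of_apply, Finset.sum_mul, Finset.mul_sum]
  rw [Finset.sum_comm]
  exact Finset.sum_congr rfl fun _ _ => Finset.sum_congr rfl fun _ _ => by ring

lemma sum_eq_sum_update (j : Fin m) (F : (Fin m → Fin 2) → ℂ) :
    ∑ u, F u = ∑ s, ∑ u with u j = 0, F (Function.update u j s) := by
  rw [← Finset.sum_fiberwise Finset.univ (fun u => u j) F]
  refine Finset.sum_congr rfl fun s _ => ?_
  refine Finset.sum_bij' (fun u _ => Function.update u j 0) (fun u _ => Function.update u j s)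
    ?_ ?_ ?_ ?_ ?_
  · simp
  · simp
  · rintro u hu
    simp only [Finset.mem_filter, Finset.mem_univ, true_and] at hu
    simp [← hu]
  · rintro u hu
    simp only [Finset.mem_filter, Finset.mem_univ, true_and] at hu
    simp [← hu]
  · rintro u hu
    simp only [Finset.mem_filter, Finset.mem_univ, true_and] at hu
    simp [← hu]

lemma onQubit_resetOp_apply (j : Fin m) (a : Fin 2 → ℂ) (F : Matrix (Fin m → Fin 2) (Fin 2) ℂ)
    (u : Fin m → Fin 2) (y : Fin 2) : onQubit j (resetOp a) F u y
      = if u j = 0 then ∑ s, star (a s) * F (Function.update u j s) y else 0 := by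
  by_cases h : u j = 0 <;> simp [onQubit, resetOp, h]

/-- One step of the protocol of Walgate et al.: two orthogonal states of a block stay orthogonal
under a suitable measurement of the qubit `j`, whatever its outcome. -/
lemma exists_measurement_orthogonal (j : Fin m) (F : Matrix (Fin m → Fin 2) (Fin 2) ℂ)
    (hF : (Fᴴ * F) 0 1 = 0) : ∃ W : Matrix (Fin 2) (Fin 2) ℂ, Wᴴ * W = 1 ∧
      ∀ i, ((onQubit j (resetOp fun s => W s i) F)ᴴ * onQubit j (resetOp fun s => W s i) F) 0 1
        = 0 := by
  -- `N` is the partial trace of `|F₁⟩⟨F₀|` over the qubits other than `j`. Its trace is the overlap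
  -- of the two columns, and the diagonal entries of `Wᴴ * N * W` are the overlaps after each
  -- outcome.
  let N : Matrix (Fin 2) (Fin 2) ℂ := Matrix.of fun t s =>
    ∑ u : Fin m → Fin 2 with u j = 0, star (F (Function.update u j s) 0) * F (Function.update u j t) 1
  have hN : N.trace = 0 := by
    rw [← hF, Matrix.mul_apply, sum_eq_sum_update j]
    simp [N, Matrix.trace]
  obtain ⟨W, hW, h⟩ := exists_unitary_diag_eq_zero N hN
  refine ⟨W, hW, fun i => ?_⟩
  rw [← h i, Matrix.mul_apply]
  simp only [Matrix.conjTranspose_apply, onQubit_resetOp_apply]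
  have h1 : ∀ u : Fin m → Fin 2,
      (star (if u j = 0 then ∑ s, star (W s i) * F (Function.update u j s) 0 else 0)) *
        (if u j = 0 then ∑ s, star (W s i) * F (Function.update u j s) 1 else 0)
      = if u j = 0 then star (∑ s, star (W s i) * F (Function.update u j s) 0) *
        (∑ s, star (W s i) * F (Function.update u j s) 1) else 0 := by
    intro u; split_ifs <;> simp
  simp only [h1]
  rw [← Finset.sum_filter]
  simp only [Matrix.mul_apply, N, Matrix.of_apply, Matrix.conjTranspose_apply, Fin.sum_univ_two,
    Finset.mul_sum, Finset.sum_mul, ← Finset.sum_add_distrib, star_add, star_mul', star_star]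
  exact Finset.sum_congr rfl fun _ _ => by ring

variable {W V : Type*} [Fintype W] [DecidableEq W] [DecidableEq V]

/-- Two orthogonal states of a block can be distinguished by LOCC, the block being reset to
`|0…0⟩`. -/
lemma canPrepare_of_distinguish (e : W × Fin m ≃ V) (w : W) (B : Matrix (Fin 2) (Fin 2) ℂ)
    (hB : Bᴴ * B = 1) {P : QState V → Prop} (T : W → Matrix (Fin m → Fin 2) (Fin 2) ℂ)
    (ψ : QState W)
    (hP : ∀ (k : ℂ) (i : Fin 2), CanPrepare P
      (blockState e (Function.update T w (resetBlock m (k • star fun y => B y i))) ψ))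
    (s : Finset (Fin m)) (T₀ : Matrix (Fin m → Fin 2) (Fin 2) ℂ)
    (hs : ∀ u, (∃ j ∉ s, u j ≠ 0) → T₀ u = 0) (hT₀ : ((T₀ * B)ᴴ * (T₀ * B)) 0 1 = 0) :
    CanPrepare P (blockState e (Function.update T w T₀) ψ) := by
  -- Here `s` holds the qubits still to be measured; `hs` says that all others are already in `|0⟩`.
  induction s using Finset.induction generalizing T₀ with
  | empty =>
    have h1 : T₀ = resetBlock m (T₀ 0) := by
      ext u y
      by_cases hu : u = 0
      · simp [resetBlock, hu]
      · rw [hs u (by simpa using Function.ne_iff.mp hu)]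
        simp [resetBlock, hu]
    have h2 : T₀ 0 = ∑ i, (T₀ * B) 0 i • star fun y => B y i := by
      have : T₀ = T₀ * B * Bᴴ := by
        rw [Matrix.mul_assoc, mul_eq_one_comm.mp hB, Matrix.mul_one]
      funext y
      conv_lhs => rw [this, Matrix.mul_apply]
      simp
    -- Only the row `0` is left, so the overlap is a single product and one of the two amplitudes
    -- vanishes. If both do, the bra is zero and either outcome may be declared.
    have h3 : star ((T₀ * B) 0 0) * (T₀ * B) 0 1 = 0 := by
      have h0 : ∀ u ≠ 0, ∀ y, (T₀ * B) u y = 0 := fun u hu y => by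
        rw [Matrix.mul_apply, hs u (by simpa using Function.ne_iff.mp hu)]
        simp
      generalize T₀ * B = F at hT₀ h0
      rw [← hT₀, Matrix.mul_apply, Finset.sum_eq_single 0]
      · simp
      · intro u _ hu
        simp [h0 u hu]
      · simp
    rw [Fin.sum_univ_two] at h2
    rcases mul_eq_zero.mp h3 with h | h
    · rw [star_eq_zero.mp h, zero_smul, zero_add] at h2
      rw [h1, h2]
      exact hP _ 1
    · rw [h, zero_smul, add_zero] at h2
      rw [h1, h2]
      exact hP _ 0
  | insert j s hj ih =>
    obtain ⟨A, hA, h⟩ := exists_measurement_orthogonal j (T₀ * B) hT₀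
    refine CanPrepare.of_step (e (w, j)) (fun i => resetOp fun s => A s i) (sum_resetOp A hA)
      fun i => ?_
    rw [applyAt_blockState, Function.update_self, Function.update_idem]
    refine ih _ ?_ (by rw [onQubit_mul]; exact h i)
    rintro u ⟨j', hj', hu⟩
    funext y
    rw [onQubit_resetOp_apply]
    split_ifs with h0
    · refine Finset.sum_eq_zero fun s _ => ?_
      have hne : j' ≠ j := by rintro rfl; exact hu h0
      rw [hs _ ⟨j', by simp [hj', hne], by simpa [hne] using hu⟩]
      simp
    · rfl

end Distinguish

/-! ### Projectors, the code isometry and the simulation of logical measurements -/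

lemma vecMul_ketBra (a b : EuclideanSpace ℂ (Fin 2)) :
    (star fun y => a y) ᵥ* ketBra b = inner ℂ a b • star fun y => b y := by
  funext y
  simp [ketBra, Matrix.vecMul, dotProduct, PiLp.inner_apply]
  ring

lemma trace_ketBra {a : EuclideanSpace ℂ (Fin 2)} (ha : ‖a‖ = 1) : (ketBra a).trace = 1 := by
  have h := inner_self_eq_norm_sq_to_K (𝕜 := ℂ) a
  rw [ha, PiLp.inner_apply] at h
  simpa [Matrix.trace, ketBra, -inner_self_eq_norm_sq_to_K] using h

lemma ketBra_mul_self {a : EuclideanSpace ℂ (Fin 2)} (ha : ‖a‖ = 1) :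
    ketBra a * ketBra a = ketBra a := by
  have h := trace_ketBra ha
  ext r s
  simp only [Matrix.trace_fin_two, ketBra, Matrix.mul_apply, Fin.sum_univ_two,
    Matrix.of_apply] at h ⊢
  linear_combination a r * star (a s) * h

lemma resetBlock_ketBra (m : ℕ) {a : EuclideanSpace ℂ (Fin 2)} (ha : ‖a‖ = 1) (k : ℂ) :
    resetBlock m (k • star fun y => a y) * ketBra a = resetBlock m (k • star fun y => a y) := by
  rw [resetBlock_mul, Matrix.smul_vecMul, vecMul_ketBra, inner_self_eq_norm_sq_to_K, ha]
  simp

/-- The isometry from the logical qubit to the block of physical qubits. -/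
def QubitCode.toMatrix {m : ℕ} (C : QubitCode m) : Matrix (Fin m → Fin 2) (Fin 2) ℂ :=
  Matrix.of fun u y => C.ket y u

lemma QubitCode.toMatrix_isometry {m : ℕ} (C : QubitCode m) : C.toMatrixᴴ * C.toMatrix = 1 := by
  ext a b
  rw [Matrix.mul_apply, Matrix.one_apply, ← C.sum_star_ket_mul_ket a b]
  rfl

section Simulation

variable {W V : Type*} [Fintype W] [DecidableEq W] {m : ℕ}

/-- The bra of a reset block absorbs the projector, `⟨a|a⟩⟨a| = ⟨a|`. Hence the physical state may
be described equally by `ψ` before or after the logical projection. -/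
lemma blockState_update_reset (e : W × Fin m ≃ V) (T : W → Matrix (Fin m → Fin 2) (Fin 2) ℂ)
    (ψ : QState W) (v : W) {a : EuclideanSpace ℂ (Fin 2)} (ha : ‖a‖ = 1) (k : ℂ) :
    blockState e (Function.update T v (resetBlock m (k • star fun y => a y)))
      (applyAt v (ketBra a) ψ)
      = blockState e (Function.update T v (resetBlock m (k • star fun y => a y))) ψ := by
  rw [blockState_applyAt, Function.update_self, resetBlock_ketBra m ha, Function.update_idem]

variable [DecidableEq V]

/-- LOCC on the physical qubits of an encoded qubit can simulate a projective measurement of the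
logical qubit, the block being reset to `|0…0⟩`. -/
lemma canPrepare_of_measure_block (C : QubitCode m) (e : W × Fin m ≃ V) (w : W)
    (B : Matrix (Fin 2) (Fin 2) ℂ) (hB : Bᴴ * B = 1) {P : QState V → Prop}
    (T : W → Matrix (Fin m → Fin 2) (Fin 2) ℂ) (hT : T w = C.toMatrix) (ψ : QState W)
    (hP : ∀ (k : ℂ) (i : Fin 2), CanPrepare P
      (blockState e (Function.update T w (resetBlock m (k • star fun y => B y i))) ψ)) :
    CanPrepare P (blockState e T ψ) := by
  have := canPrepare_of_distinguish e w B hB T ψ hP Finset.univ C.toMatrix (by simp) (by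
    rw [Matrix.conjTranspose_mul, Matrix.mul_assoc, ← Matrix.mul_assoc C.toMatrixᴴ,
      C.toMatrix_isometry, Matrix.one_mul, hB]
    simp)
  rwa [← hT, Function.update_eq_self] at this

/-- Measure all the logical qubits in `s`. -/
lemma canPrepare_of_measure_blocks (C : QubitCode m) (e : W × Fin m ≃ V)
    (B : W → Matrix (Fin 2) (Fin 2) ℂ) (hB : ∀ w, (B w)ᴴ * B w = 1) {P : QState V → Prop}
    (ψ : QState W) (s : Finset W) (T : W → Matrix (Fin m → Fin 2) (Fin 2) ℂ)
    (hT : ∀ w ∈ s, T w = C.toMatrix)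
    (hP : ∀ T' : W → Matrix (Fin m → Fin 2) (Fin 2) ℂ, (∀ w ∉ s, T' w = T w) →
      (∀ w ∈ s, ∃ (k : ℂ) (i : Fin 2), T' w = resetBlock m (k • star fun y => B w y i)) →
      CanPrepare P (blockState e T' ψ)) :
    CanPrepare P (blockState e T ψ) := by
  induction s using Finset.induction generalizing T with
  | empty => exact hP T (by simp) (by simp)
  | insert v s hv ih =>
    refine canPrepare_of_measure_block C e v (B v) (hB v) T (hT v (by simp)) ψ fun k i => ?_
    refine ih _ (fun w hw => ?_) fun T' h h' => hP T' (fun w hw => ?_) fun w hw => ?_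
    · have : w ≠ v := by rintro rfl; exact hv hw
      rw [Function.update_of_ne this, hT w (by simp [hw])]
    · rw [Finset.mem_insert, not_or] at hw
      rw [h w hw.2, Function.update_of_ne hw.1]
    · by_cases hws : w ∈ s
      · exact h' w hws
      · obtain rfl : w = v := by simpa [hws] using hw
        exact ⟨k, i, by rw [h w hws, Function.update_self]⟩

/-- The maps `T` describe a simulation of a measurement protocol, the state of which is `ψ`: each
logical qubit either is still encoded, or has been measured and reset, in which case it is in a
known pure state in `ψ`. -/
def Tracks (C : QubitCode m) (T : W → Matrix (Fin m → Fin 2) (Fin 2) ℂ) (ψ : QState W) : Prop :=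
  ∀ w, T w = C.toMatrix ∨ ∃ (k : ℂ) (a : EuclideanSpace ℂ (Fin 2)), ‖a‖ = 1 ∧
    T w = resetBlock m (k • star fun y => a y) ∧ applyAt w (ketBra a) ψ = ψ

/-- The new record holds because the projector is idempotent; older records of other qubits survive
because operators on different qubits commute. -/
lemma Tracks.measure {C : QubitCode m} {T : W → Matrix (Fin m → Fin 2) (Fin 2) ℂ} {ψ : QState W}
    (h : Tracks C T ψ) (v : W) {a : EuclideanSpace ℂ (Fin 2)} (ha : ‖a‖ = 1) (k : ℂ) :
    Tracks C (Function.update T v (resetBlock m (k • star fun y => a y)))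
      (applyAt v (ketBra a) ψ) := by
  intro w
  by_cases hw : w = v
  · subst hw
    refine Or.inr ⟨k, a, ha, by simp, ?_⟩
    rw [applyAt_applyAt, ketBra_mul_self ha]
  · rw [Function.update_of_ne hw]
    refine (h w).imp_right ?_
    rintro ⟨k', a', ha', hT, hψ⟩
    exact ⟨k', a', ha', hT, by rw [applyAt_comm hw, hψ]⟩

/-- LOCC on the physical qubits can simulate a protocol of projective measurements of the logical
qubits. -/
lemma canPrepare_of_simulation (C : QubitCode m) (e : W × Fin m ≃ V) {P : QState W → Prop}
    {P' : QState V → Prop}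
    (hP : ∀ T ψ, Tracks C T ψ → P ψ → CanPrepare P' (blockState e T ψ))
    (p : MeasurementProtocol W) (T : W → Matrix (Fin m → Fin 2) (Fin 2) ℂ) (ψ : QState W)
    (hT : Tracks C T ψ) (hp : p.AllBranches P ψ) : CanPrepare P' (blockState e T ψ) := by
  induction p generalizing T ψ with
  | done => exact hP T ψ hT hp
  | measure v b next ih =>
    rcases hT v with h | ⟨k, a, ha, h, hψ⟩
    · refine canPrepare_of_measure_block C e v (Matrix.of fun r i => b i r) ?_ T h ψ
        fun k i => ?_
      · ext i j
        rw [Matrix.one_apply, ← orthonormal_iff_ite.mp b.orthonormal i j, PiLp.inner_apply,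
          Matrix.mul_apply]
        exact Finset.sum_congr rfl fun _ _ => by simp [mul_comm]
      · have hb := b.orthonormal.1 i
        have := ih i _ _ (hT.measure v hb k) (hp i)
        rwa [blockState_update_reset e T ψ v hb k] at this
    -- A repeated measurement: the block is already reset and no physical step is taken. Since `a`
    -- has a non-zero component along some `b i`, rescaling `k` by that component makes the present
    -- physical state fit branch `i` of the logical protocol.
    · obtain ⟨i, hi⟩ : ∃ i, inner ℂ (b i) a ≠ 0 := by
        by_contra! h0
        have := b.sum_repr' a
        simp only [h0, zero_smul, Finset.sum_const_zero] at this
        simp [← this] at ha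
      have hb := b.orthonormal.1 i
      have := ih i _ _ (hT.measure v hb (k / inner ℂ (b i) a)) (hp i)
      rw [blockState_update_reset e T ψ v hb] at this
      conv at this =>
        arg 2
        rw [← hψ]
      rwa [blockState_applyAt, Function.update_self, Function.update_idem, resetBlock_mul,
        Matrix.smul_vecMul, vecMul_ketBra, smul_smul, div_mul_cancel₀ _ hi, ← h,
        Function.update_eq_self] at this

end Simulation

/-! ### States padded with `|0⟩`, and local unitaries -/

section Place

variable {W V : Type*} [Fintype W] [DecidableEq W]

lemma placeState_placeState [Fintype V] [DecidableEq V] {A : Type*} [Fintype A] [DecidableEq A]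
    (e : W ↪ V) (f : A ↪ W) (φ : QState A) :
    placeState e (placeState f φ) = placeState (f.trans e) φ := by
  ext x
  have h : (∀ v, v ∉ Set.range (f.trans e) → x v = 0) ↔
      (∀ v, v ∉ Set.range e → x v = 0) ∧ ∀ w, w ∉ Set.range f → x (e w) = 0 := by
    constructor
    · refine fun h => ⟨fun v hv => h v ?_, fun w hw => h _ ?_⟩
      · rintro ⟨a, rfl⟩; exact hv ⟨f a, rfl⟩
      · rintro ⟨a, ha⟩; exact hw ⟨a, e.injective ha⟩
    · rintro ⟨h1, h2⟩ v hv
      by_cases hve : v ∈ Set.range e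
      · obtain ⟨w, rfl⟩ := hve
        exact h2 w fun ⟨a, ha⟩ => hv ⟨a, by simp [ha]⟩
      · exact h1 v hve
  simp only [placeState, h]
  split_ifs with h1 h2 h3 h3 h3
  · rfl
  · exact absurd ⟨h1, h2⟩ h3
  · exact absurd h3.2 h2
  · rfl
  · exact absurd h3.1 h1
  · rfl

lemma applyAt_placeState [Fintype V] [DecidableEq V] (e : W ↪ V) (w : W) (A : Matrix (Fin 2) (Fin 2) ℂ)
    (φ : QState W) : applyAt (e w) A (placeState e φ) = placeState e (applyAt w A φ) := by
  ext x
  have h1 : ∀ b, (∀ v, v ∉ Set.range e → Function.update x (e w) b v = 0) ↔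
      ∀ v, v ∉ Set.range e → x v = 0 := by
    refine fun b => forall₂_congr fun v hv => ?_
    rw [Function.update_of_ne]
    rintro rfl
    exact hv ⟨w, rfl⟩
  have h2 : ∀ b, (fun w' => Function.update x (e w) b (e w'))
      = Function.update (fun w' => x (e w')) w b := by
    intro b
    funext w'
    simp [Function.update_apply]
  simp only [applyAt, placeState, h1, h2]
  split_ifs <;> simp

lemma placeState_eq_zero [Fintype V] [DecidableEq V] {e : W ↪ V} {φ : QState W}
    (h : placeState e φ = 0) : φ = 0 := by
  rw [← norm_eq_zero, ← norm_placeState e, h, norm_zero]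

lemma prodMap_placeState [Fintype V] [DecidableEq V] {α : Type*} (T : V → Matrix α (Fin 2) ℂ)
    (e : W ↪ V) (φ : QState W) (x : V → α) :
    prodMap T (placeState e φ) x
      = (∏ v ∈ (Finset.univ.map e)ᶜ, T v (x v) 0) *
        prodMap (fun w => T (e w)) φ (fun w => x (e w)) := by
  simp only [prodMap, Finset.mul_sum]
  symm
  refine Finset.sum_of_injOn (fun y => Function.extend e y 0) ?_ (by simp) ?_ ?_
  · intro y _ z _ h
    funext w
    simpa [e.injective.extend_apply] using congrFun h (e w)
  · intro y _ hy
    have : ¬ ∀ v, v ∉ Set.range e → y v = 0 := by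
      intro h
      refine hy ⟨fun w => y (e w), by simp, ?_⟩
      funext v
      by_cases hv : v ∈ Set.range e
      · obtain ⟨w, rfl⟩ := hv
        exact e.injective.extend_apply _ _ w
      · dsimp only
        rw [Function.extend_apply' _ _ _ (by simpa using hv), h v hv]
        rfl
    simp only [placeState]
    rw [if_neg this, mul_zero]
  · intro y _
    have h : ∀ v, v ∉ Set.range e → Function.extend e y 0 v = 0 := fun v hv => by
      rw [Function.extend_apply' _ _ _ (by simpa using hv)]
      rfl
    simp only [placeState]
    rw [if_pos h, ← Finset.prod_mul_prod_compl (Finset.univ.map e), Finset.prod_map]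
    simp only [e.injective.extend_apply]
    have h' : ∏ v ∈ (Finset.univ.map e)ᶜ, T v (x v) (Function.extend e y 0 v)
        = ∏ v ∈ (Finset.univ.map e)ᶜ, T v (x v) 0 :=
      Finset.prod_congr rfl fun v hv => by rw [h v (by simpa using hv)]
    rw [h']
    ring

end Place

section Local

variable {W : Type*} [Fintype W] [DecidableEq W]

lemma localOp_eq_zero {U : W → Matrix (Fin 2) (Fin 2) ℂ} (hU : ∀ w, (U w)ᴴ * U w = 1)
    {ψ : QState W} (h : localOp U ψ = 0) : ψ = 0 := by
  have h1 : localOp (fun w => (U w)ᴴ) (localOp U ψ) = ψ := by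
    rw [localOp_localOp]
    simp only [hU, localOp_one]
  rw [← h1, h]
  simpa using localOp_smul (fun w => (U w)ᴴ) 0 (0 : QState W)

lemma applyAt_eq_zero_of_localOp {U : W → Matrix (Fin 2) (Fin 2) ℂ} (hU : ∀ w, (U w)ᴴ * U w = 1)
    {v : W} {A : Matrix (Fin 2) (Fin 2) ℂ} {ψ : QState W} (h : applyAt v A (localOp U ψ) = 0) :
    applyAt v (A * U v) ψ = 0 := by
  refine localOp_eq_zero (U := Function.update U v 1) (fun w => ?_) ?_
  · by_cases hw : w = v
    · subst hw; simp
    · simp [hw, hU]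
  · rw [← h, applyAt_eq_localOp, applyAt_eq_localOp, localOp_localOp, localOp_localOp]
    congr 1
    funext w
    by_cases hw : w = v
    · subst hw; simp
    · simp [hw]

end Local

/-! ### An entangled state without factorizing qubits -/

section Entangled

variable {A B : Type*} [Fintype A] [DecidableEq A] [Fintype B] [DecidableEq B]

/-- The product of a state of the qubits `A` and the computational basis state `z` of the
qubits `B`. -/
noncomputable def tensorKet (ξ : QState A) (z : B → Fin 2) : QState (A ⊕ B) :=
  WithLp.toLp 2 fun y => if y ∘ Sum.inr = z then ξ (y ∘ Sum.inl) else 0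

lemma prodMap_tensorKet {α : Type*} (T : A ⊕ B → Matrix α (Fin 2) ℂ) (ξ : QState A)
    (z : B → Fin 2) (x : A ⊕ B → α) :
    prodMap T (tensorKet ξ z) x = (∏ b, T (Sum.inr b) (x (Sum.inr b)) (z b)) *
      prodMap (fun a => T (Sum.inl a)) ξ (fun a => x (Sum.inl a)) := by
  simp only [prodMap, Finset.mul_sum]
  symm
  refine Finset.sum_of_injOn (fun y => Sum.elim y z) ?_ (by simp) ?_ ?_
  · intro y _ y' _ h
    simpa using congrArg (· ∘ Sum.inl) h
  · intro y _ hy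
    have : y ∘ Sum.inr ≠ z := fun h => hy ⟨y ∘ Sum.inl, by simp, by
      simp [← h]⟩
    simp [tensorKet, this]
  · intro y _
    simp [tensorKet, Fintype.prod_sum_type]
    ring

/-- The identity and two Pauli matrices. -/
def pauli : Fin 3 → Matrix (Fin 2) (Fin 2) ℂ := ![1, !![0, 1; 1, 0], !![1, 0; 0, -1]]

lemma pauli_unitary (g : Fin 3) : pauli g ∈ Matrix.unitaryGroup (Fin 2) ℂ := by
  rw [Matrix.mem_unitaryGroup_iff']
  fin_cases g
  · simp [pauli]
  all_goals
    ext i j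
    fin_cases i <;> fin_cases j <;> simp [pauli, Matrix.star_eq_conjTranspose, Matrix.mul_apply]

/-- A state of the qubits `A` and three auxiliary qubits, no qubit of which factorizes, from which
measurements of the auxiliary qubits prepare `φ` up to local unitaries. -/
noncomputable def entangledState (φ : QState A) : QState (A ⊕ Fin 3) :=
  ∑ g, tensorKet (localOp (fun _ => pauli g) φ) (Pi.single g 1)

lemma entangledState_elim (φ : QState A) (z : A → Fin 2) (s : Fin 3 → Fin 2) :
    entangledState φ (Sum.elim z s)
      = ∑ g, if s = Pi.single g 1 then localOp (fun _ => pauli g) φ z else 0 := by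
  simp [entangledState, tensorKet]
  rfl

lemma entangledState_single (φ : QState A) (z : A → Fin 2) (g : Fin 3) :
    entangledState φ (Sum.elim z (Pi.single g 1)) = localOp (fun _ => pauli g) φ z := by
  have h : ∀ g g' : Fin 3, (Pi.single g 1 : Fin 3 → Fin 2) = Pi.single g' 1 ↔ g = g' := by decide
  simp [entangledState_elim, h]

lemma eq_zero_of_localOp_pauli {φ : QState A} {g : Fin 3}
    (h : ∀ z, localOp (fun _ => pauli g) φ z = 0) : φ = 0 :=
  localOp_eq_zero (fun _ => Matrix.mem_unitaryGroup_iff'.mp (pauli_unitary g))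
    (PiLp.ext h : localOp (fun _ => pauli g) φ = 0)

/-- Restricting to each auxiliary string shows that `M * pauli g` annihilates `φ` for every `g`. In
a non-zero row of `M`, the identity and Z together separate the two terms, and X exchanges the
amplitudes, so both amplitudes vanish. -/
lemma applyAt_inl_entangledState {φ : QState A} {k : A} {M : Matrix (Fin 2) (Fin 2) ℂ}
    (hM : M ≠ 0) (h : applyAt (Sum.inl k) M (entangledState φ) = 0) : φ = 0 := by
  have h1 : ∀ g, applyAt k (M * pauli g) φ = 0 := by
    intro g
    refine applyAt_eq_zero_of_localOp (U := fun _ => pauli g)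
      (fun _ => Matrix.mem_unitaryGroup_iff'.mp (pauli_unitary g)) ?_
    ext z
    rw [show (0 : QState A) z = (0 : QState (A ⊕ Fin 3)) (Sum.elim z (Pi.single g 1)) from rfl, ← h]
    simp only [applyAt, Sum.elim_inl, ← Sum.elim_update_left, entangledState_single]
  obtain ⟨r, s, hrs⟩ : ∃ r s, M r s ≠ 0 := by
    by_contra! h0
    exact hM (Matrix.ext h0)
  ext x
  have h2 : ∀ g, ∑ b, (M * pauli g) r b * φ (Function.update x k b) = 0 := by
    intro g
    have := congrArg (fun ψ : QState A => ψ (Function.update x k r)) (h1 g)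
    simpa [applyAt] using this
  have e0 := h2 0
  have e1 := h2 1
  have e2 := h2 2
  simp [pauli, Fin.sum_univ_two, Matrix.mul_apply] at e0 e1 e2
  rw [← Function.update_eq_self k x]
  have p0 : M r 0 * φ (Function.update x k 0) = 0 := by linear_combination (e0 + e2) / 2
  have p1 : M r 1 * φ (Function.update x k 1) = 0 := by linear_combination (e0 - e2) / 2
  have key : φ (Function.update x k 0) = 0 ∧ φ (Function.update x k 1) = 0 := by
    fin_cases s
    · have h0 : φ (Function.update x k 0) = 0 := (mul_eq_zero.mp p0).resolve_left hrs
      rw [h0, mul_zero, zero_add] at e1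
      exact ⟨h0, (mul_eq_zero.mp e1).resolve_left hrs⟩
    · have h0 : φ (Function.update x k 1) = 0 := (mul_eq_zero.mp p1).resolve_left hrs
      rw [h0, mul_zero, add_zero] at e1
      exact ⟨(mul_eq_zero.mp e1).resolve_left hrs, h0⟩
  generalize x k = b
  fin_cases b
  · exact key.1
  · exact key.2

/-- Flipping one bit never leads from a weight-one string to another, so of two amplitudes that `M`
combines at most one is non-zero. A non-zero entry in column `0` is tested on the string with its
one at `h + 1`, an index different from `h`; one in column `1` on the string with its one at `h`. -/
lemma applyAt_inr_entangledState {φ : QState A} {h : Fin 3} {M : Matrix (Fin 2) (Fin 2) ℂ}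
    (hM : M ≠ 0) (h0 : applyAt (Sum.inr h) M (entangledState φ) = 0) : φ = 0 := by
  obtain ⟨r, s, hrs⟩ : ∃ r s, M r s ≠ 0 := by
    by_contra! h0
    exact hM (Matrix.ext h0)
  have h1 : ∀ (z : A → Fin 2) (t : Fin 3 → Fin 2),
      ∑ b, M r b * entangledState φ (Sum.elim z (Function.update t h b)) = 0 := by
    intro z t
    have := congrArg (fun ψ : QState (A ⊕ Fin 3) => ψ (Sum.elim z (Function.update t h r))) h0
    simpa [applyAt, ← Sum.elim_update_right] using this
  have hs : s = 0 ∨ s = 1 := by omega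
  rcases hs with rfl | rfl
  · refine eq_zero_of_localOp_pauli (g := h + 1) fun z => ?_
    have h2 : ∀ h : Fin 3, Function.update (Pi.single (h + 1) 1 : Fin 3 → Fin 2) h 0
      = Pi.single (h + 1) 1 := by decide
    have h3 : ∀ h g : Fin 3, Function.update (Pi.single (h + 1) 1 : Fin 3 → Fin 2) h 1
      ≠ Pi.single g 1 := by decide
    have := h1 z (Pi.single (h + 1) 1)
    rw [Fin.sum_univ_two, h2, entangledState_single, entangledState_elim] at this
    simpa [h3, hrs] using this
  · refine eq_zero_of_localOp_pauli (g := h) fun z => ?_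
    have h2 : ∀ g : Fin 3, (0 : Fin 3 → Fin 2) ≠ Pi.single g 1 := by decide
    have := h1 z 0
    rw [Fin.sum_univ_two, ← Pi.single, entangledState_elim, ← Pi.single,
      entangledState_single] at this
    simpa [h2, hrs] using this

/-- No qubit of `entangledState φ` factorizes. -/
lemma applyAt_entangledState {φ : QState A} {a : A ⊕ Fin 3} {M : Matrix (Fin 2) (Fin 2) ℂ}
    (hM : M ≠ 0) (h : applyAt a M (entangledState φ) = 0) : φ = 0 := by
  rcases a with k | k
  · exact applyAt_inl_entangledState hM h
  · exact applyAt_inr_entangledState hM h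

end Entangled

/-! ### Reading out the auxiliary blocks -/

section Readout

variable {A W V : Type*} [Fintype A] [DecidableEq A] [Fintype W] [DecidableEq W] [Fintype V]
  [DecidableEq V] {m : ℕ}

lemma prodMap_sum {α ι : Type*} (T : W → Matrix α (Fin 2) ℂ) (s : Finset ι) (ψ : ι → QState W)
    (x : W → α) : prodMap T (∑ i ∈ s, ψ i) x = ∑ i ∈ s, prodMap T (ψ i) x := by
  simp only [prodMap, WithLp.ofLp_sum, Finset.sum_apply, Finset.mul_sum]
  exact Finset.sum_comm

lemma QubitCode.encode_apply (C : QubitCode m) (φ : QState W) (x : W × Fin m → Fin 2) :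
    C.encode φ x = prodMap (fun _ => C.toMatrix) φ fun w j => x (w, j) := by
  simp only [QubitCode.encode, prodMap, mul_comm]
  rfl

lemma placeState_encode_eq_blockState (C : QubitCode m) (e : W × Fin m ≃ V) (f : W × Fin m ↪ V)
    (hf : ∀ p, f p = e p) (φ : QState W) :
    placeState f (C.encode φ) = blockState e (fun _ => C.toMatrix) φ := by
  ext x
  have h : ∀ v, v ∉ Set.range f → x v = 0 := fun v hv =>
    absurd ⟨e.symm v, by rw [hf, e.apply_symm_apply]⟩ hv
  simp only [placeState, if_pos h, blockState, ← hf]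
  exact C.encode_apply φ _

/-- By `hB` each auxiliary block admits only one bit value. Two distinct weight-one strings cannot
both be admitted by all three blocks, so at most one Pauli term survives. -/
lemma blockState_entangledState (C : QubitCode m) (e : W × Fin m ≃ V) (f : A ⊕ Fin 3 ↪ W)
    (pos : A × Fin m ↪ V) (hpos : ∀ a j, pos (a, j) = e (f (Sum.inl a), j))
    (S : W → Matrix (Fin m → Fin 2) (Fin 2) ℂ) (U : A → Matrix (Fin 2) (Fin 2) ℂ)
    (hS : ∀ a, S (f (Sum.inl a)) = C.toMatrix * U a)
    (hR : ∀ w, (∀ a, f (Sum.inl a) ≠ w) → ∃ η, S w = resetBlock m η)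
    (hB : ∀ b, ∃ i, ∀ r ≠ i, ∀ u, S (f (Sum.inr b)) u r = 0) (φ : QState A) :
    ∃ (c : ℂ) (g : Fin 3), blockState e S (placeState f (entangledState φ))
      = c • placeState pos (C.encode (localOp U (localOp (fun _ => pauli g) φ))) := by
  have hrange : ∀ (x : V → Fin 2), (∀ v, v ∉ Set.range pos → x v = 0) ↔
      ∀ w, (∀ a, f (Sum.inl a) ≠ w) → (fun j => x (e (w, j))) = 0 := by
    refine fun x => ⟨fun h w hw => funext fun j => h _ ?_, fun h v hv => ?_⟩
    · rintro ⟨⟨a, j'⟩, h'⟩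
      rw [hpos, e.apply_eq_iff_eq, Prod.mk.injEq] at h'
      exact hw a h'.1
    · obtain ⟨⟨w, j⟩, rfl⟩ := e.surjective v
      refine congrFun (h w ?_) j
      rintro a rfl
      exact hv ⟨(a, j), hpos a j⟩
  obtain ⟨g₀, hg₀⟩ : ∃ g₀ : Fin 3, ∀ g ≠ g₀,
      ∏ b, S (f (Sum.inr b)) 0 ((Pi.single g 1 : Fin 3 → Fin 2) b) = 0 := by
    by_cases h : ∃ g₀ : Fin 3,
      ∏ b, S (f (Sum.inr b)) 0 ((Pi.single g₀ 1 : Fin 3 → Fin 2) b) ≠ 0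
    · obtain ⟨g₀, h⟩ := h
      refine ⟨g₀, fun g hg => ?_⟩
      obtain ⟨i, hi⟩ := hB g
      have h1 : (Pi.single g₀ 1 : Fin 3 → Fin 2) g = i := by
        by_contra hne
        exact Finset.prod_ne_zero_iff.mp h g (Finset.mem_univ g) (hi _ hne 0)
      refine Finset.prod_eq_zero (Finset.mem_univ g) (hi _ ?_ 0)
      rw [← h1, Pi.single_eq_same, Pi.single_eq_of_ne hg]
      decide
    · push Not at h
      -- No term survives: the coefficient will be zero and the choice of Pauli is immaterial.
      exact ⟨0, fun g _ => h g⟩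
  refine ⟨(∏ w ∈ (Finset.univ.map f)ᶜ, S w 0 0) *
    ∏ b, S (f (Sum.inr b)) 0 ((Pi.single g₀ 1 : Fin 3 → Fin 2) b), g₀, ?_⟩
  ext x
  simp only [blockState, placeState, PiLp.smul_apply, smul_eq_mul]
  split_ifs with hx
  · rw [hrange] at hx
    rw [← placeState, prodMap_placeState]
    have h1 : ∏ w ∈ (Finset.univ.map f)ᶜ, S w (fun j => x (e (w, j))) 0
        = ∏ w ∈ (Finset.univ.map f)ᶜ, S w 0 0 := by
      refine Finset.prod_congr rfl fun w hw => ?_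
      rw [hx w]
      rintro a rfl
      simp at hw
    rw [h1, mul_assoc, entangledState, prodMap_sum, Finset.sum_eq_single g₀]
    · rw [prodMap_tensorKet, C.encode_apply, prodMap_localOp _ U]
      simp only [hS, hpos]
      congr 2
      refine Finset.prod_congr rfl fun b _ => ?_
      rw [hx]
      intro a h
      simpa using f.injective h
    · intro g _ hg
      rw [prodMap_tensorKet]
      refine mul_eq_zero_of_left ?_ _
      rw [← hg₀ g hg]
      refine Finset.prod_congr rfl fun b _ => ?_
      rw [hx]
      intro a h
      simpa using f.injective h
    · simp
  · rw [hrange] at hx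
    push Not at hx
    obtain ⟨w, hw, hx⟩ := hx
    obtain ⟨η, hη⟩ := hR w hw
    rw [mul_zero]
    refine Finset.sum_eq_zero fun y _ => mul_eq_zero_of_left ?_ _
    refine Finset.prod_eq_zero (Finset.mem_univ w) ?_
    rw [hη]
    exact if_neg hx

/-- The factor must be non-zero because every operator fixes the zero vector, which would make the
records empty of content. -/
lemma Tracks.of_smul {C : QubitCode m} {T : W → Matrix (Fin m → Fin 2) (Fin 2) ℂ} {c : ℂ}
    {ψ : QState W} (hc : c ≠ 0) (h : Tracks C T (c • ψ)) : Tracks C T ψ := by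
  refine fun w => (h w).imp_right ?_
  rintro ⟨k, a, ha, hT, hψ⟩
  rw [applyAt_eq_localOp, localOp_smul, ← applyAt_eq_localOp] at hψ
  exact ⟨k, a, ha, hT, smul_right_injective _ hc hψ⟩

/-- In a branch of a simulated measurement protocol which has prepared an entangled state on output
qubits none of which factorizes, the output qubits are still encoded. -/
lemma Tracks.eq_toMatrix {C : QubitCode m} {T : W → Matrix (Fin m → Fin 2) (Fin 2) ℂ}
    {U : W → Matrix (Fin 2) (Fin 2) ℂ} (hU : ∀ w, (U w)ᴴ * U w = 1) {f : A ⊕ Fin 3 ↪ W}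
    {φ : QState A} (hφ : φ ≠ 0) (h : Tracks C T (localOp U (placeState f (entangledState φ))))
    (a : A ⊕ Fin 3) : T (f a) = C.toMatrix := by
  refine (h (f a)).resolve_right ?_
  rintro ⟨k, b, hb, -, hψ⟩
  -- Had this qubit been measured, `1 - |b⟩⟨b|` would annihilate the prepared state; moved past the
  -- local unitaries, it becomes `(1 - ketBra b) * U (f a)` acting on `entangledState φ`. It is
  -- non-zero since `1 - |b⟩⟨b|` has trace `1`.
  refine hφ (applyAt_entangledState (a := a) (M := (1 - ketBra b) * U (f a)) ?_ ?_)
  · intro h0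
    have h1 : 1 - ketBra b = 0 := by
      have := congrArg (· * (U (f a))ᴴ) h0
      simpa only [Matrix.mul_assoc, mul_eq_one_comm.mp (hU (f a)), Matrix.mul_one,
        Matrix.zero_mul] using this
    have h2 := congrArg Matrix.trace h1
    rw [Matrix.trace_sub, trace_ketBra hb] at h2
    norm_num at h2
  · apply placeState_eq_zero (e := f)
    rw [← applyAt_placeState]
    apply applyAt_eq_zero_of_localOp hU
    rw [applyAt_one_sub, hψ, sub_self]

/-- From a simulated measurement protocol that has prepared `entangledState φ` up to local
unitaries, LOCC prepares the encoded version of `φ` up to logical local unitaries. -/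
lemma canPrepare_of_entangledState (C : QubitCode m) (e : W × Fin m ≃ V) (f : A ⊕ Fin 3 ↪ W)
    (pos : A × Fin m ↪ V) (hpos : ∀ a j, pos (a, j) = e (f (Sum.inl a), j))
    (T : W → Matrix (Fin m → Fin 2) (Fin 2) ℂ) (U : W → Matrix (Fin 2) (Fin 2) ℂ)
    (hU : ∀ w, (U w)ᴴ * U w = 1) {φ : QState A} (hφ : φ ≠ 0)
    (h : Tracks C T (localOp U (placeState f (entangledState φ)))) (c : ℂ) :
    CanPrepare (fun χ => ∃ (c : ℂ) (g : Fin 3), χ = c • placeState pos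
      (C.encode (localOp (fun a => U (f (Sum.inl a))) (localOp (fun _ => pauli g) φ))))
      (blockState e T (c • localOp U (placeState f (entangledState φ)))) := by
  classical
  have hC := h.eq_toMatrix hU hφ
  -- All blocks still encoded, except the outputs, are measured in the columns of `U w`. The
  -- resulting bra times `U w` is a multiple of a computational basis bra, so the local unitaries on
  -- the auxiliary qubits drop out.
  refine canPrepare_of_measure_blocks C e U hU _
    (Finset.univ.filter fun w => T w = C.toMatrix ∧ ∀ a, f (Sum.inl a) ≠ w) T
    (fun w hw => (Finset.mem_filter.mp hw).2.1) ?_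
  intro T' h1 h2
  refine CanPrepare.of_done ?_
  rw [blockState_smul, blockState_localOp]
  refine (blockState_entangledState C e f pos hpos (fun w => T' w * U w)
    (fun a => U (f (Sum.inl a))) (fun a => ?_) (fun w hw => ?_) (fun b => ?_) φ).elim
    fun c' ⟨g, hg⟩ => ⟨c * c', g, by rw [hg, smul_smul]⟩
  · rw [h1 _ (by simp), hC]
  · by_cases hT : T w = C.toMatrix
    · obtain ⟨k, i, h'⟩ := h2 w (by simp [hT, hw])
      exact ⟨_, by rw [h', resetBlock_mul]⟩
    · obtain ⟨k, a, -, h', -⟩ := (h w).resolve_left hT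
      exact ⟨_, by rw [h1 _ (by simp [hT]), h', resetBlock_mul]⟩
  · obtain ⟨k, i, h'⟩ := h2 (f (Sum.inr b)) (by simp [hC])
    refine ⟨i, fun r hr u => ?_⟩
    have h3 := congrFun (congrFun (hU (f (Sum.inr b))) i) r
    rw [Matrix.mul_apply, Matrix.one_apply_ne hr.symm] at h3
    simp only [Matrix.conjTranspose_apply] at h3
    rw [h', resetBlock_mul]
    simp only [resetBlock, Matrix.of_apply, Matrix.vecMul, dotProduct, Pi.smul_apply, Pi.star_apply,
      smul_eq_mul, mul_assoc, ← Finset.mul_sum, h3, mul_zero, ite_self]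

end Readout

/-! ### Assembly of the theorem -/

lemma entangledState_ne_zero {A : Type*} [Fintype A] [DecidableEq A] {φ : QState A} (hφ : φ ≠ 0) :
    entangledState φ ≠ 0 := by
  intro h
  refine hφ (eq_zero_of_localOp_pauli (g := 0) fun z => ?_)
  rw [← entangledState_single, h]
  rfl

lemma placeState_smul {A V : Type*} [Fintype A] [Fintype V] [DecidableEq V] (e : A ↪ V)
    (c : ℂ) (φ : QState A) : placeState e (c • φ) = c • placeState e φ := by
  ext x
  simp only [placeState, PiLp.smul_apply, smul_eq_mul, mul_ite, mul_zero]

/-- A resource that prepares all states of `n` qubits prepares all states of any finite system of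
qubits, up to normalization. -/
lemma ResourceFamily.IsUniversalByMeasurements.exists_protocol {L : Type*} [DecidableEq L]
    {Ψ : ResourceFamily L} (hΨ : Ψ.IsUniversalByMeasurements) {A : Type*} [Fintype A]
    [DecidableEq A] (ω : QState A) (hω : ω ≠ 0) :
    ∃ (i : ℕ) (f : A ↪ Ψ.qubits i) (p : MeasurementProtocol (Ψ.qubits i)),
      p.AllBranches
        (fun χ => ∃ (c : ℂ) (U : Ψ.qubits i → Matrix.unitaryGroup (Fin 2) ℂ),
          χ = c • localOp (fun v => (U v : Matrix (Fin 2) (Fin 2) ℂ)) (placeState f ω))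
        (Ψ.state i) := by
  let σ := Fintype.equivFin A
  obtain ⟨i, e, p, hp⟩ := hΨ (Fintype.card A)
    (placeState σ.toEmbedding (((‖ω‖⁻¹ : ℝ) : ℂ) • ω)) (by
      rw [norm_placeState, norm_smul, Complex.norm_real, norm_inv, norm_norm,
        inv_mul_cancel₀ (norm_ne_zero_iff.mpr hω)])
  refine ⟨i, σ.toEmbedding.trans e, p, ?_⟩
  convert hp using 2 with χ
  simp only [placeState_placeState, placeState_smul, localOp_smul, smul_smul]
  constructor
  · rintro ⟨c, U, rfl⟩
    refine ⟨c * ‖ω‖, U, ?_⟩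
    rw [mul_assoc, ← Complex.ofReal_mul, mul_inv_cancel₀ (norm_ne_zero_iff.mpr hω),
      Complex.ofReal_one, mul_one]
  · rintro ⟨c, U, rfl⟩
    exact ⟨_, U, rfl⟩

lemma CanPrepare.imp {V : Type*} [DecidableEq V] {P P' : QState V → Prop} {ψ : QState V}
    (hψ : CanPrepare P ψ) (h : ∀ χ, P χ → P' χ) : CanPrepare P' ψ := by
  obtain ⟨p, hp⟩ := hψ
  refine ⟨p, ?_⟩
  induction p generalizing ψ with
  | done => exact h ψ hp
  | step v k K hK next ih => exact fun i => ih i (hp i)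

theorem mainTheorem10 {L Q : Type*} [DecidableEq L] [DecidableEq Q]
    (Ψ : ResourceFamily L) (hΨ : Ψ.IsUniversalByMeasurements)
    {m : ℕ} (C : QubitCode m) (block : L × Fin m ↪ Q) :
    (Ψ.encodings C block).IsEncodedUniversal := by
  intro n φ hφ
  have hφ0 : φ ≠ 0 := norm_ne_zero_iff.mp (by rw [hφ]; exact one_ne_zero)
  obtain ⟨i, f, p, hp⟩ := hΨ.exists_protocol (entangledState φ) (entangledState_ne_zero hφ0)
  let pos := physicalPosition block (Ψ.qubits i)
  have hsurj : Function.Surjective pos := by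
    rintro ⟨q, hq⟩
    obtain ⟨⟨l, j⟩, hl, rfl⟩ := Finset.mem_map.mp hq
    exact ⟨(⟨l, (Finset.mem_product.mp hl).1⟩, j), rfl⟩
  let e := Equiv.ofBijective pos ⟨pos.injective, hsurj⟩
  let d : Fin n ↪ Ψ.qubits i := Function.Embedding.inl.trans f
  refine ⟨i, d, ?_⟩
  change CanPrepare _ (placeState pos (C.encode (Ψ.state i)))
  rw [placeState_encode_eq_blockState C e pos fun _ => rfl]
  refine canPrepare_of_simulation C e ?_ p _ _ (fun w => Or.inl rfl) hp
  rintro T ψ hT ⟨c, U, rfl⟩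
  -- For `c = 0` the records say nothing about the output blocks, but the physical state is zero and
  -- the multiple `0` suffices.
  by_cases hc : c = 0
  · refine CanPrepare.of_done ⟨0, 1, ?_⟩
    rw [hc, blockState_smul]
    simp only [zero_smul]
    rfl
  · have hU : ∀ w, (U w : Matrix (Fin 2) (Fin 2) ℂ)ᴴ * U w = 1 := fun w =>
      Matrix.mem_unitaryGroup_iff'.mp (U w).2
    refine (canPrepare_of_entangledState C e f ((Ψ.encodings C block).position d)
      (fun _ _ => rfl) T _ hU hφ0 (hT.of_smul hc) c).imp ?_
    rintro χ ⟨c', g, rfl⟩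
    refine ⟨c', fun a => U (f (Sum.inl a)) * ⟨pauli g, pauli_unitary g⟩, ?_⟩
    rw [QubitCode.logicalLocalOp_encode, localOp_localOp]
    rfl
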